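/- Let $\Omega\subset\mathbb R^d$ be a bounded domain and $\Gamma\subseteq\Omega$ a subdomain (nonempty, open, connected). Let $H^2_0(\Omega)$ denote the space of functions in $H^2(\Omega)$ with zero trace on $\partial\Omega$, that is $H^2(\Omega)\cap H^1_0(\Omega)$, and assume $H^2$ regularity with a constant $C$: $\|u\|_{H^2(\Omega)}\le C\|\Delta u\|_{L^2(\Omega)}$ for all $u\in H^2_0(\Omega)$. For $\beta,\gamma>0$ let $V_\beta=L^2(\Gamma)\cap\beta H^2_0(\Omega)$, $G_\beta=\beta L^2(\Omega)$, $M_\beta=\frac1\beta L^2(\Omega)$, that is, $H^2_0(\Omega)$, $L^2(\Omega)$, $L^2(\Omega)$ with the norms $$\|u\|_{V_\beta}^2=\|u\|_{L^2(\Gamma)}^2+\beta^2\|\Delta u\|_{L^2(\Omega)}^2,\qquad \|f\|_{G_\beta}=\beta\|f\|_{L^2(\Omega)},\qquad \|\lambda\|_{M_\beta}=\tfrac1\beta\|\lambda\|_{L^2(\Omega)}.$$ For $u_d\in L^2(\Gamma)$ and $f_p\in L^2(\Omega)$ consider the following three problems. (A) Minimize $\gamma^2\|-\Delta v-g\|_{L^2(\Omega)}^2+\|v-u_d\|_{L^2(\Gamma)}^2+\beta^2\|g-f_p\|_{L^2(\Omega)}^2$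 over $(v,g)\in V_\beta\times G_\beta$. (B) Find $(u,f)\in V_\beta\times G_\beta$ such that for all $v\in V_\beta$, $g\in G_\beta$ $$(u,v)_\Gamma+\gamma^2(-\Delta u-f,-\Delta v)_\Omega=(u_d,v)_\Gamma,\qquad \gamma^2(-\Delta u,-g)_\Omega+(\beta^2+\gamma^2)(f,g)_\Omega=\beta^2(f_p,g)_\Omega .$$ (C) Find $(u,f,\lambda)\in V_\beta\times G_\beta\times M_\beta$ such that for all $v\in V_\beta$, $g\in G_\beta$, $\mu\in M_\beta$ $$(u,v)_\Gamma+(\lambda,-\Delta v)_\Omega=(u_d,v)_\Gamma,\quad \beta^2(f,g)_\Omega+(\lambda,-g)_\Omega=\beta^2(f_p,g)_\Omega,\quad (-\Delta u-f,\mu)_\Omega-\tfrac1{\gamma^2}(\lambda,\mu)_\Omega=0 .$$ Call a problem well-posed with constant $K$ if for all data $(u_d,f_p)$ it has exactly one solution, and the difference of the solutions for two pairs of data, measured in the norm of $V_\beta$ plus that of $G_\beta$ (plus that of $M_\beta$ for (C)), is at most $K\big(\|u_d-u_d'\|_{L^2(\Gamma)}+\beta\|f_p-f_p'\|_{L^2(\Omega)}\big)$;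 for (B) and (C) we require moreover that, if the right-hand sides are replaced by arbitrary bounded linear functionals on $V_\beta$, $G_\beta$ (and $M_\beta$), there is exactly one solution, and its norm is at most $K$ times the sum of the dual norms of the functionals. Then there is a constant $K$, depending only on $d$ and $C$, such that: 1. if $\gamma>0$ and $1/\gamma<\beta$, then (A), (B) and (C) are well-posed with constant $K\,(1+\beta^2/\gamma^2)$; 2. if $0<\beta\le\gamma$, then (A), (B) and (C) are well-posed with constant $K$, independent of $\beta$ and $\gamma$; 3. for every $\beta>0$ the limit case $\gamma=\infty$ of (C), in which the term $\frac1{\gamma^2}(\lambda,\mu)_\Omega$ is absent, is well-posed with constant $K$. -/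

import Mathlib

open MeasureTheory

namespace InverseProblem

/-- Euclidean space `ℝ^d`. -/
abbrev E (d : ℕ) : Type := EuclideanSpace ℝ (Fin d)

/-- The real Hilbert space `L²(X)` for a subset `X` of `ℝ^d`, with Lebesgue measure. -/
abbrev L2 {d : ℕ} (X : Set (E d)) : Type := Lp ℝ 2 (volume.restrict X)

/-- A bounded domain: a bounded, open, connected, nonempty set. -/
def IsBoundedDomain {d : ℕ} (Ω : Set (E d)) : Prop :=
  IsOpen Ω ∧ IsConnected Ω ∧ Bornology.IsBounded Ω

/-- `Γ` is a subdomain of `Ω`: an open connected nonempty subset (it may be proper). -/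
def IsSubdomain {d : ℕ} (Γ Ω : Set (E d)) : Prop :=
  IsOpen Γ ∧ IsConnected Γ ∧ Γ ⊆ Ω

/-- Test functions `C_c^∞(Ω)`. -/
def IsTest {d : ℕ} (Ω : Set (E d)) (φ : E d → ℝ) : Prop :=
  ContDiff ℝ (⊤ : ℕ∞) φ ∧ HasCompactSupport φ ∧ tsupport φ ⊆ Ω

/-- The classical partial derivative `∂ᵢ φ`. -/
noncomputable def partialD {d : ℕ} (i : Fin d) (φ : E d → ℝ) (x : E d) : ℝ :=
  fderiv ℝ φ x (EuclideanSpace.single i 1)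

/-- `w` is the weak partial derivative `∂ᵢ u` in `Ω`. -/
def HasWeakPartial {d : ℕ} (Ω : Set (E d)) (i : Fin d) (u w : L2 Ω) : Prop :=
  ∀ φ : E d → ℝ, IsTest Ω φ →
    ∫ x in Ω, u x * partialD i φ x = - ∫ x in Ω, w x * φ x

theorem IsTest.memLp {d : ℕ} {Ω : Set (E d)} {φ : E d → ℝ} (h : IsTest Ω φ) :
    MemLp φ 2 (volume.restrict Ω) :=
  h.1.continuous.memLp_of_hasCompactSupport h.2.1

theorem IsTest.memLp_partialD {d : ℕ} {Ω : Set (E d)} {φ : E d → ℝ} (h : IsTest Ω φ)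
    (i : Fin d) : MemLp (partialD i φ) 2 (volume.restrict Ω) := by
  refine Continuous.memLp_of_hasCompactSupport ?_ ?_
  · exact (h.1.continuous_fderiv (by simp)).clm_apply continuous_const
  · exact h.2.1.fderiv_apply ℝ (v := EuclideanSpace.single i (1 : ℝ))

theorem IsTest.zero {d : ℕ} (Ω : Set (E d)) : IsTest Ω (0 : E d → ℝ) :=
  ⟨contDiff_const, HasCompactSupport.zero, by simp [tsupport]⟩

theorem IsTest.add {d : ℕ} {Ω : Set (E d)} {φ ψ : E d → ℝ} (hφ : IsTest Ω φ)
    (hψ : IsTest Ω ψ) : IsTest Ω (φ + ψ) :=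
  ⟨hφ.1.add hψ.1, hφ.2.1.add hψ.2.1,
    (tsupport_add φ ψ).trans (Set.union_subset hφ.2.2 hψ.2.2)⟩

theorem IsTest.smul {d : ℕ} {Ω : Set (E d)} {φ : E d → ℝ} (c : ℝ) (hφ : IsTest Ω φ) :
    IsTest Ω (c • φ) :=
  ⟨hφ.1.const_smul c, hφ.2.1.smul_left (f := fun _ => c),
    (tsupport_smul_subset_right (fun _ => c) φ).trans hφ.2.2⟩

theorem partialD_add {d : ℕ} {Ω : Set (E d)} {φ ψ : E d → ℝ} (hφ : IsTest Ω φ)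
    (hψ : IsTest Ω ψ) (i : Fin d) : partialD i (φ + ψ) = partialD i φ + partialD i ψ := by
  funext x
  have h1 : DifferentiableAt ℝ φ x := (hφ.1.differentiable (by simp)) x
  have h2 : DifferentiableAt ℝ ψ x := (hψ.1.differentiable (by simp)) x
  simp [partialD, fderiv_add h1 h2]

theorem partialD_smul {d : ℕ} {Ω : Set (E d)} {φ : E d → ℝ} (c : ℝ) (hφ : IsTest Ω φ)
    (i : Fin d) : partialD i (c • φ) = c • partialD i φ := by
  funext x
  have h1 : DifferentiableAt ℝ φ x := (hφ.1.differentiable (by simp)) x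
  simp [partialD, fderiv_const_smul h1 c]

theorem HasWeakPartial.zero {d : ℕ} (Ω : Set (E d)) (i : Fin d) :
    HasWeakPartial Ω i 0 0 := by
  intro φ _
  have h0 := Lp.coeFn_zero ℝ 2 (volume.restrict Ω)
  have e : ∀ ψ : E d → ℝ, ∫ x in Ω, (0 : L2 Ω) x * ψ x = 0 := fun ψ =>
    integral_eq_zero_of_ae (h0.mono fun x hx => by
      show (0 : L2 Ω) x * ψ x = 0
      rw [hx, Pi.zero_apply, zero_mul])
  rw [e, e, neg_zero]

theorem HasWeakPartial.add {d : ℕ} {Ω : Set (E d)} {i : Fin d} {u u' w w' : L2 Ω}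
    (h : HasWeakPartial Ω i u w) (h' : HasWeakPartial Ω i u' w') :
    HasWeakPartial Ω i (u + u') (w + w') := by
  intro φ hφ
  have e : ∀ (a b : L2 Ω) (ψ : E d → ℝ), MemLp ψ 2 (volume.restrict Ω) →
      ∫ x in Ω, (a + b) x * ψ x = (∫ x in Ω, a x * ψ x) + ∫ x in Ω, b x * ψ x := by
    intro a b ψ hψ
    have ha : Integrable (fun x => a x * ψ x) (volume.restrict Ω) :=
      (Lp.memLp a).integrable_mul hψ
    have hb : Integrable (fun x => b x * ψ x) (volume.restrict Ω) :=
      (Lp.memLp b).integrable_mul hψ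
    rw [← integral_add ha hb]
    refine integral_congr_ae ((Lp.coeFn_add a b).mono fun x hx => ?_)
    simp only [hx, Pi.add_apply]
    ring
  rw [e _ _ _ (hφ.memLp_partialD i), e _ _ _ hφ.memLp, h φ hφ, h' φ hφ]
  ring

theorem HasWeakPartial.smul {d : ℕ} {Ω : Set (E d)} {i : Fin d} {u w : L2 Ω} (c : ℝ)
    (h : HasWeakPartial Ω i u w) : HasWeakPartial Ω i (c • u) (c • w) := by
  intro φ hφ
  have e : ∀ (a : L2 Ω) (ψ : E d → ℝ),
      ∫ x in Ω, (c • a) x * ψ x = c * ∫ x in Ω, a x * ψ x := by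
    intro a ψ
    rw [← integral_const_mul]
    refine integral_congr_ae ((Lp.coeFn_smul c a).mono fun x hx => ?_)
    simp only [hx, Pi.smul_apply, smul_eq_mul]
    ring
  rw [e, e, h φ hφ]
  ring

/-- Weak partial derivatives in an open set are unique. -/
theorem HasWeakPartial.unique {d : ℕ} {Ω : Set (E d)} (hΩ : IsOpen Ω) {i : Fin d}
    {u w w' : L2 Ω} (h : HasWeakPartial Ω i u w) (h' : HasWeakPartial Ω i u w') :
    w = w' := by
  have key : ∀ᵐ x ∂(volume.restrict Ω), x ∈ Ω → (w - w') x = 0 := by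
    refine hΩ.ae_eq_zero_of_integral_contDiff_smul_eq_zero
      (((Lp.memLp (w - w')).locallyIntegrable (by norm_num)).locallyIntegrableOn Ω) ?_
    intro φ h1 h2 h3
    have hφ : IsTest Ω φ := ⟨h1, h2, h3⟩
    have e : ∫ x in Ω, φ x • (w - w') x
        = (∫ x in Ω, w x * φ x) - ∫ x in Ω, w' x * φ x := by
      have ha : Integrable (fun x => w x * φ x) (volume.restrict Ω) :=
        (Lp.memLp w).integrable_mul hφ.memLp
      have hb : Integrable (fun x => w' x * φ x) (volume.restrict Ω) :=
        (Lp.memLp w').integrable_mul hφ.memLp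
      rw [← integral_sub ha hb]
      refine integral_congr_ae ((Lp.coeFn_sub w w').mono fun x hx => ?_)
      simp only [hx, Pi.sub_apply, smul_eq_mul]
      ring
    rw [e]
    linarith [h φ hφ, h' φ hφ]
  refine sub_eq_zero.mp (Lp.ext ?_)
  filter_upwards [key, ae_restrict_mem hΩ.measurableSet,
    Lp.coeFn_zero ℝ 2 (volume.restrict Ω)] with x hx hxΩ h0
  rw [hx hxΩ, h0]
  rfl

/-- `u ∈ H²(Ω)`: all weak partial derivatives of order at most two exist in `L²(Ω)`. -/
def MemH2 {d : ℕ} (Ω : Set (E d)) (u : L2 Ω) : Prop :=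
  ∃ (p : Fin d → L2 Ω) (q : Fin d → Fin d → L2 Ω),
    (∀ i, HasWeakPartial Ω i u (p i)) ∧ ∀ i j, HasWeakPartial Ω j (p i) (q i j)

/-- `u ∈ H¹₀(Ω)` (zero trace): `u` lies in the closure of `C_c^∞(Ω)` in `H¹(Ω)`. -/
def MemH10 {d : ℕ} (Ω : Set (E d)) (u : L2 Ω) : Prop :=
  ∃ p : Fin d → L2 Ω, (∀ i, HasWeakPartial Ω i u (p i)) ∧
    ∀ ε : ℝ, 0 < ε → ∃ (φ : E d → ℝ) (hφ : IsTest Ω φ),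
      ‖u - hφ.memLp.toLp φ‖ < ε ∧
      ∀ i, ‖p i - (hφ.memLp_partialD i).toLp (partialD i φ)‖ < ε

/-- `H²₀(Ω)`: the space of the functions in `H²(Ω)` with zero trace on `∂Ω`, that is,
`H²(Ω) ∩ H¹₀(Ω)`; no condition is put on the normal derivative. -/
def H20 {d : ℕ} (Ω : Set (E d)) : Submodule ℝ (L2 Ω) where
  carrier := {u | MemH2 Ω u ∧ MemH10 Ω u}
  zero_mem' := by
    refine ⟨⟨0, 0, fun i => HasWeakPartial.zero Ω i, fun _ j => HasWeakPartial.zero Ω j⟩,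
      ⟨0, fun i => HasWeakPartial.zero Ω i, fun ε hε => ⟨0, IsTest.zero Ω, ?_, fun i => ?_⟩⟩⟩
    · rw [MemLp.toLp_zero]
      simpa using hε
    · have h0 : partialD i (0 : E d → ℝ) = 0 := by
        funext x
        simp [partialD]
      have : ((IsTest.zero Ω).memLp_partialD i).toLp (partialD i 0) = (0 : L2 Ω) := by
        simp only [h0]
        exact MemLp.toLp_zero _
      rw [this]
      simpa using hε
  add_mem' := by
    rintro u u' ⟨⟨p, q, hp, hq⟩, ⟨r, hr, hr'⟩⟩ ⟨⟨p', q', hp', hq'⟩, ⟨s, hs, hs'⟩⟩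
    refine ⟨⟨p + p', q + q', fun i => (hp i).add (hp' i), fun i j => (hq i j).add (hq' i j)⟩,
      ⟨r + s, fun i => (hr i).add (hs i), fun ε hε => ?_⟩⟩
    obtain ⟨φ, hφ, a, b⟩ := hr' (ε / 2) (half_pos hε)
    obtain ⟨ψ, hψ, a', b'⟩ := hs' (ε / 2) (half_pos hε)
    refine ⟨φ + ψ, hφ.add hψ, ?_, fun i => ?_⟩
    · rw [MemLp.toLp_add hφ.memLp hψ.memLp, add_sub_add_comm]
      exact (norm_add_le _ _).trans_lt (by linarith)
    · have : ((hφ.add hψ).memLp_partialD i).toLp (partialD i (φ + ψ))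
          = (hφ.memLp_partialD i).toLp _ + (hψ.memLp_partialD i).toLp _ := by
        rw [← MemLp.toLp_add]
        simp only [partialD_add hφ hψ]
      rw [this, Pi.add_apply, add_sub_add_comm]
      exact (norm_add_le _ _).trans_lt (by linarith [b i, b' i])
  smul_mem' := by
    rintro c u ⟨⟨p, q, hp, hq⟩, ⟨r, hr, hr'⟩⟩
    refine ⟨⟨c • p, c • q, fun i => (hp i).smul c, fun i j => (hq i j).smul c⟩,
      ⟨c • r, fun i => (hr i).smul c, fun ε hε => ?_⟩⟩
    have hc : 0 < |c| + 1 := by positivity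
    have aux : ∀ a : L2 Ω, ‖a‖ < ε / (|c| + 1) → ‖c • a‖ < ε := by
      intro a ha
      rw [norm_smul, Real.norm_eq_abs]
      rw [lt_div_iff₀ hc] at ha
      nlinarith [norm_nonneg a, abs_nonneg c]
    obtain ⟨φ, hφ, a, b⟩ := hr' (ε / (|c| + 1)) (by positivity)
    refine ⟨c • φ, hφ.smul c, ?_, fun i => ?_⟩
    · rw [MemLp.toLp_const_smul c hφ.memLp, ← smul_sub]
      exact aux _ a
    · have : ((hφ.smul c).memLp_partialD i).toLp (partialD i (c • φ))
          = c • (hφ.memLp_partialD i).toLp _ := by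
        rw [← MemLp.toLp_const_smul]
        simp only [partialD_smul c hφ]
      rw [this, Pi.smul_apply, ← smul_sub]
      exact aux _ (b i)

open Classical in
/-- The weak partial derivative `∂ᵢ u` as an element of `L²(Ω)` (`0` if it does not exist;
this value is never used on `H²(Ω)`). For open `Ω` it is unique. -/
noncomputable def weakPartial {d : ℕ} (Ω : Set (E d)) (i : Fin d) (u : L2 Ω) : L2 Ω :=
  if h : ∃ w, HasWeakPartial Ω i u w then h.choose else 0

theorem weakPartial_eq {d : ℕ} {Ω : Set (E d)} (hΩ : IsOpen Ω) {i : Fin d} {u w : L2 Ω}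
    (h : HasWeakPartial Ω i u w) : weakPartial Ω i u = w := by
  have hex : ∃ w, HasWeakPartial Ω i u w := ⟨w, h⟩
  rw [weakPartial, dif_pos hex]
  exact hex.choose_spec.unique hΩ h

/-- The Laplacian `Δu = ∑ᵢ ∂ᵢ∂ᵢ u`, for `u ∈ H²(Ω)`. -/
noncomputable def lap {d : ℕ} {Ω : Set (E d)} (u : L2 Ω) : L2 Ω :=
  ∑ i, weakPartial Ω i (weakPartial Ω i u)

/-- The full norm of `H²(Ω)`. -/
noncomputable def h2Norm {d : ℕ} {Ω : Set (E d)} (u : L2 Ω) : ℝ :=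
  Real.sqrt (‖u‖ ^ 2 + ∑ i, ‖weakPartial Ω i u‖ ^ 2
    + ∑ i, ∑ j, ‖weakPartial Ω j (weakPartial Ω i u)‖ ^ 2)

/-- `H²` regularity of the Dirichlet problem with constant `C`:
`‖u‖_{H²(Ω)} ≤ C ‖Δu‖_{L²(Ω)}` for all `u ∈ H²₀(Ω)`. -/
def H2Regularity {d : ℕ} (Ω : Set (E d)) (C : ℝ) : Prop :=
  ∀ u : H20 Ω, h2Norm (u : L2 Ω) ≤ C * ‖lap (u : L2 Ω)‖

/-- The inner product `(u, v)_Γ` of `L²(Γ)`, for functions that are square integrable on `Γ`. -/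
noncomputable def innerOn {d : ℕ} (Γ : Set (E d)) (u v : E d → ℝ) : ℝ :=
  ∫ x in Γ, u x * v x

/-- The norm of `V_β = L²(Γ) ∩ β H²₀(Ω)`: `‖u‖² = ‖u‖²_{L²(Γ)} + β² ‖Δu‖²_{L²(Ω)}`. -/
noncomputable def vNorm {d : ℕ} {Ω : Set (E d)} (Γ : Set (E d)) (β : ℝ) (u : H20 Ω) : ℝ :=
  Real.sqrt (innerOn Γ (u : L2 Ω) (u : L2 Ω) + β ^ 2 * ‖lap (u : L2 Ω)‖ ^ 2)

/-- The norm of `G_β = β L²(Ω)`. -/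
noncomputable def gNorm {d : ℕ} {Ω : Set (E d)} (β : ℝ) (f : L2 Ω) : ℝ := β * ‖f‖

/-- The norm of `M_β = β⁻¹ L²(Ω)`. -/
noncomputable def mNorm {d : ℕ} {Ω : Set (E d)} (β : ℝ) (l : L2 Ω) : ℝ := 1 / β * ‖l‖

/-- The least squares functional
`γ² ‖-Δv - g‖²_{L²(Ω)} + ‖v - u_d‖²_{L²(Γ)} + β² ‖g - f_p‖²_{L²(Ω)}`. -/
noncomputable def lossL2 {d : ℕ} {Ω Γ : Set (E d)} (β γ : ℝ) (ud : L2 Γ) (fp : L2 Ω)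
    (v : H20 Ω) (g : L2 Ω) : ℝ :=
  γ ^ 2 * ‖-lap (v : L2 Ω) - g‖ ^ 2 + (∫ x in Γ, ((v : L2 Ω) x - ud x) ^ 2)
    + β ^ 2 * ‖g - fp‖ ^ 2

/-- `(u, f)` minimizes the least squares functional over `V_β × G_β`. -/
def IsMinimizer {d : ℕ} {Ω Γ : Set (E d)} (β γ : ℝ) (ud : L2 Γ) (fp : L2 Ω)
    (u : H20 Ω) (f : L2 Ω) : Prop :=
  ∀ (v : H20 Ω) (g : L2 Ω), lossL2 β γ ud fp u f ≤ lossL2 β γ ud fp v g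

/-- `(u, f)` solves the reduced variational system with right-hand sides `F`, `G`. -/
def IsVarSolution {d : ℕ} {Ω : Set (E d)} (Γ : Set (E d)) (β γ : ℝ)
    (F : H20 Ω → ℝ) (G : L2 Ω → ℝ) (u : H20 Ω) (f : L2 Ω) : Prop :=
  (∀ v : H20 Ω, innerOn Γ (u : L2 Ω) (v : L2 Ω)
      + γ ^ 2 * inner ℝ (-lap (u : L2 Ω) - f) (-lap (v : L2 Ω)) = F v) ∧
  (∀ g : L2 Ω, γ ^ 2 * inner ℝ (-lap (u : L2 Ω)) (-g)
      + (β ^ 2 + γ ^ 2) * inner ℝ f g = G g)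

/-- `(u, f, l)` solves the saddle-point system with penalty coefficient `κ` and right-hand
sides `F`, `G`, `H`. The penalized Lagrangian system has `κ = 1 / γ²`; `κ = 0` is the
case `γ = ∞`. -/
def IsSaddleSolution {d : ℕ} {Ω : Set (E d)} (Γ : Set (E d)) (β κ : ℝ)
    (F : H20 Ω → ℝ) (G H : L2 Ω → ℝ) (u : H20 Ω) (f l : L2 Ω) : Prop :=
  (∀ v : H20 Ω, innerOn Γ (u : L2 Ω) (v : L2 Ω)
      + inner ℝ l (-lap (v : L2 Ω)) = F v) ∧
  (∀ g : L2 Ω, β ^ 2 * inner ℝ f g + inner ℝ l (-g) = G g) ∧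
  (∀ m : L2 Ω, inner ℝ (-lap (u : L2 Ω) - f) m - κ * inner ℝ l m = H m)

/-- The right-hand side `v ↦ (u_d, v)_Γ`. -/
noncomputable def obsRhs {d : ℕ} {Γ : Set (E d)} (Ω : Set (E d)) (ud : L2 Γ)
    (v : H20 Ω) : ℝ := innerOn Γ ud (v : L2 Ω)

/-- The right-hand side `g ↦ β² (f_p, g)_Ω`. -/
noncomputable def priorRhs {d : ℕ} {Ω : Set (E d)} (β : ℝ) (fp : L2 Ω) (g : L2 Ω) : ℝ :=
  β ^ 2 * inner ℝ fp g

/-- Well-posedness of the minimization problem in `V_β × G_β` with stability constant `K`: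
existence, uniqueness, and Lipschitz dependence on the data `u_d`, `f_p`. -/
def MinimizationWellPosed {d : ℕ} (Ω Γ : Set (E d)) (β γ K : ℝ) : Prop :=
  (∀ (ud : L2 Γ) (fp : L2 Ω), ∃! s : H20 Ω × L2 Ω, IsMinimizer β γ ud fp s.1 s.2) ∧
  (∀ (ud ud' : L2 Γ) (fp fp' : L2 Ω) (u u' : H20 Ω) (f f' : L2 Ω),
    IsMinimizer β γ ud fp u f → IsMinimizer β γ ud' fp' u' f' →
    vNorm Γ β (u - u') + gNorm β (f - f') ≤ K * (‖ud - ud'‖ + gNorm β (fp - fp')))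

/-- Well-posedness of the reduced variational system in `V_β × G_β` with stability constant
`K`: existence, uniqueness and Lipschitz dependence on the data `u_d`, `f_p`, and likewise for
arbitrary right-hand sides in the dual spaces, of norm at most `a` and `b`. -/
def VariationalWellPosed {d : ℕ} (Ω Γ : Set (E d)) (β γ K : ℝ) : Prop :=
  (∀ (ud : L2 Γ) (fp : L2 Ω), ∃! s : H20 Ω × L2 Ω,
    IsVarSolution Γ β γ (obsRhs Ω ud) (priorRhs β fp) s.1 s.2) ∧
  (∀ (ud ud' : L2 Γ) (fp fp' : L2 Ω) (u u' : H20 Ω) (f f' : L2 Ω),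
    IsVarSolution Γ β γ (obsRhs Ω ud) (priorRhs β fp) u f →
    IsVarSolution Γ β γ (obsRhs Ω ud') (priorRhs β fp') u' f' →
    vNorm Γ β (u - u') + gNorm β (f - f') ≤ K * (‖ud - ud'‖ + gNorm β (fp - fp'))) ∧
  (∀ (F : H20 Ω →ₗ[ℝ] ℝ) (G : L2 Ω →ₗ[ℝ] ℝ) (a b : ℝ), 0 ≤ a → 0 ≤ b →
    (∀ v, |F v| ≤ a * vNorm Γ β v) → (∀ g, |G g| ≤ b * gNorm β g) →
    (∃! s : H20 Ω × L2 Ω, IsVarSolution Γ β γ F G s.1 s.2) ∧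
    ∀ (u : H20 Ω) (f : L2 Ω), IsVarSolution Γ β γ F G u f →
      vNorm Γ β u + gNorm β f ≤ K * (a + b))

/-- Well-posedness of the saddle-point system with penalty coefficient `κ` in
`V_β × G_β × M_β` with stability constant `K`: existence, uniqueness and Lipschitz dependence
on the data `u_d`, `f_p`, and likewise for arbitrary right-hand sides in the dual spaces, of
norm at most `a`, `b` and `c`. -/
def SaddleWellPosed {d : ℕ} (Ω Γ : Set (E d)) (β κ K : ℝ) : Prop :=
  (∀ (ud : L2 Γ) (fp : L2 Ω), ∃! s : H20 Ω × L2 Ω × L2 Ω,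
    IsSaddleSolution Γ β κ (obsRhs Ω ud) (priorRhs β fp) 0 s.1 s.2.1 s.2.2) ∧
  (∀ (ud ud' : L2 Γ) (fp fp' : L2 Ω) (u u' : H20 Ω) (f f' l l' : L2 Ω),
    IsSaddleSolution Γ β κ (obsRhs Ω ud) (priorRhs β fp) 0 u f l →
    IsSaddleSolution Γ β κ (obsRhs Ω ud') (priorRhs β fp') 0 u' f' l' →
    vNorm Γ β (u - u') + gNorm β (f - f') + mNorm β (l - l')
      ≤ K * (‖ud - ud'‖ + gNorm β (fp - fp'))) ∧
  (∀ (F : H20 Ω →ₗ[ℝ] ℝ) (G H : L2 Ω →ₗ[ℝ] ℝ) (a b c : ℝ), 0 ≤ a → 0 ≤ b → 0 ≤ c →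
    (∀ v, |F v| ≤ a * vNorm Γ β v) → (∀ g, |G g| ≤ b * gNorm β g) →
    (∀ m, |H m| ≤ c * mNorm β m) →
    (∃! s : H20 Ω × L2 Ω × L2 Ω, IsSaddleSolution Γ β κ F G H s.1 s.2.1 s.2.2) ∧
    ∀ (u : H20 Ω) (f l : L2 Ω), IsSaddleSolution Γ β κ F G H u f l →
      vNorm Γ β u + gNorm β f + mNorm β l ≤ K * (a + b + c))

/-- All three formulations of the inverse problem are well-posed with constant `K`. -/
def InverseWellPosed {d : ℕ} (Ω Γ : Set (E d)) (β γ K : ℝ) : Prop :=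
  MinimizationWellPosed Ω Γ β γ K ∧ VariationalWellPosed Ω Γ β γ K ∧
    SaddleWellPosed Ω Γ β (1 / γ ^ 2) K

end InverseProblem

/-! Write `A` for the negative Laplacian on `H20 Ω` and `R` for the restriction to `Γ`. In the
saddle-point system the equations tested by `g` and `m` are tested against all of `L²(Ω)`, so with
Riesz representatives `y`, `z` of their right-hand sides they are the algebraic identities `β² f - l
= y` and `A u - f - κ l = z`. Put `D = 1 + κ β²`. Then `D l = β² A u - (β² z + y)` and `D f = A u +
κ y - z`, and the remaining equation becomes `(R u, R v) + (β² / D) (A u, A v) = F v + (β² z + y, A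
v) / D`.

The left side is an inner product for which the space is complete: by `H²` regularity, convergence
of `A (x n)` forces convergence of all derivatives up to order two, and weak derivatives and zero
trace survive the limit (`exists_tendsto_H20`). Riesz then gives existence (`SaddleSystem.exists`).
Testing with `v = u` and multiplying by `D` bounds `u`, and the identities above bound `f` and `l`
(`SaddleSystem.bound`), with total constant `5 D`; uniqueness is the case of zero data. The
regularity constant is used only qualitatively, for injectivity and completeness, and does not enter
the estimate.

For `κ = 1 / γ²`, problem (B) is (C) with `l = γ² (A u - f)` eliminated (`isVarSolution_iff`), and
(A) is a convex quadratic problem with Euler-Lagrange equations (B) (`isMinimizer_iff`). Here `D = 1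
+ β² / γ²`, which is at most `2` if `β ≤ γ`, and `D = 1` if `κ = 0`. -/

namespace InverseProblem

/-! ### Saddle-point systems for abstract operators on Hilbert spaces. -/

section Abstract

variable {U H P : Type*} [AddCommGroup U] [Module ℝ U]
  [NormedAddCommGroup H] [InnerProductSpace ℝ H]
  [NormedAddCommGroup P] [InnerProductSpace ℝ P]

/-- The pair `(R, A)` of linear maps has sequentially closed range. -/
def PairClosedRange (A : U →ₗ[ℝ] H) (R : U →ₗ[ℝ] P) : Prop :=
  ∀ (x : ℕ → U) (r : P) (s : H), Filter.Tendsto (fun n => R (x n)) Filter.atTop (nhds r) →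
    Filter.Tendsto (fun n => A (x n)) Filter.atTop (nhds s) → ∃ u, R u = r ∧ A u = s

/-- The energy norm `(‖R u‖² + β² ‖A u‖²)^(1/2)`. -/
noncomputable def energyNorm (A : U →ₗ[ℝ] H) (R : U →ₗ[ℝ] P) (β : ℝ) (u : U) : ℝ :=
  Real.sqrt (‖R u‖ ^ 2 + β ^ 2 * ‖A u‖ ^ 2)

theorem energyNorm_nonneg (A : U →ₗ[ℝ] H) (R : U →ₗ[ℝ] P) (β : ℝ) (u : U) :
    0 ≤ energyNorm A R β u := Real.sqrt_nonneg _

theorem energyNorm_sq (A : U →ₗ[ℝ] H) (R : U →ₗ[ℝ] P) (β : ℝ) (u : U) :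
    energyNorm A R β u ^ 2 = ‖R u‖ ^ 2 + β ^ 2 * ‖A u‖ ^ 2 :=
  Real.sq_sqrt (by positivity)

theorem norm_fst_le_energyNorm (A : U →ₗ[ℝ] H) (R : U →ₗ[ℝ] P) (β : ℝ) (u : U) :
    ‖R u‖ ≤ energyNorm A R β u :=
  Real.le_sqrt_of_sq_le (by nlinarith [mul_nonneg (sq_nonneg β) (sq_nonneg ‖A u‖)])

theorem norm_snd_le_energyNorm (A : U →ₗ[ℝ] H) (R : U →ₗ[ℝ] P) (β : ℝ) (u : U) :
    β * ‖A u‖ ≤ energyNorm A R β u :=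
  Real.le_sqrt_of_sq_le (by nlinarith [sq_nonneg ‖R u‖])

/-- `U` carries no topology of its own. It is identified through `u ↦ (R u, A u)` with a closed
subspace of the Hilbert space `P × H`, where the Riesz theorem applies. -/
theorem exists_riesz_pair_one [CompleteSpace H] [CompleteSpace P] {A : U →ₗ[ℝ] H}
    {R : U →ₗ[ℝ] P} (hA : Function.Injective A) (hcl : PairClosedRange A R)
    (F : U →ₗ[ℝ] ℝ) (a : ℝ) (hF : ∀ v, |F v| ≤ a * energyNorm A R 1 v) :
    ∃ u, ∀ v, inner ℝ (R u) (R v) + inner ℝ (A u) (A v) = F v := by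
  let T : U →ₗ[ℝ] WithLp 2 (P × H) :=
    (WithLp.linearEquiv 2 ℝ (P × H)).symm.toLinearMap ∘ₗ (R.prod A)
  have hT1 : ∀ u, (T u).fst = R u := fun _ => rfl
  have hT2 : ∀ u, (T u).snd = A u := fun _ => rfl
  have hinj : Function.Injective T := fun x y h => hA (by rw [← hT2, ← hT2, h])
  have hclosed : IsClosed (LinearMap.range T : Set (WithLp 2 (P × H))) := by
    refine IsSeqClosed.isClosed fun y z hy hz => ?_
    choose x hx using hy
    have h1 := ((WithLp.prod_continuous_ofLp 2 P H).fst.tendsto z).comp hz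
    have h2 := ((WithLp.prod_continuous_ofLp 2 P H).snd.tendsto z).comp hz
    obtain ⟨u, hu1, hu2⟩ := hcl x z.fst z.snd (h1.congr fun n => by simp [← hx n, T])
      (h2.congr fun n => by simp [← hx n, T])
    refine ⟨u, ?_⟩
    apply (WithLp.linearEquiv 2 ℝ (P × H)).injective
    exact Prod.ext hu1 hu2
  have : CompleteSpace (LinearMap.range T) := hclosed.completeSpace_coe
  let e := LinearEquiv.ofInjective T hinj
  have hnorm : ∀ v, energyNorm A R 1 v = ‖T v‖ := by
    intro v
    rw [WithLp.prod_norm_eq_of_L2, hT1, hT2, energyNorm]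
    simp
  let φ : LinearMap.range T →L[ℝ] ℝ := (F ∘ₗ e.symm.toLinearMap).mkContinuous a (by
    intro y
    have := hF (e.symm y)
    rw [hnorm] at this
    have h2 : T (e.symm y) = y := by
      rw [← LinearEquiv.ofInjective_apply (h := hinj)]
      exact congrArg Subtype.val (e.apply_symm_apply y)
    rw [h2] at this
    simpa using this)
  refine ⟨e.symm ((InnerProductSpace.toDual ℝ _).symm φ), fun v => ?_⟩
  have h := InnerProductSpace.toDual_symm_apply (𝕜 := ℝ) (x := e v) (y := φ)
  have h3 : φ (e v) = F v := by simp [φ]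
  rw [h3, Submodule.coe_inner, WithLp.prod_inner_apply] at h
  set y := (InnerProductSpace.toDual ℝ (LinearMap.range T)).symm φ
  have h2 : T (e.symm y) = y := by
    rw [← LinearEquiv.ofInjective_apply (h := hinj)]
    exact congrArg Subtype.val (e.apply_symm_apply y)
  rw [← h2] at h
  exact h

/-- The weight is absorbed by replacing `A` with `c • A`, which preserves injectivity and closed
range. -/
theorem exists_riesz_pair [CompleteSpace H] [CompleteSpace P] {A : U →ₗ[ℝ] H}
    {R : U →ₗ[ℝ] P} (hA : Function.Injective A) (hcl : PairClosedRange A R)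
    {c : ℝ} (hc : 0 < c) (F : U →ₗ[ℝ] ℝ) (a b : ℝ) (ha : 0 ≤ a) (hb : 0 ≤ b)
    (hF : ∀ v, |F v| ≤ a * ‖R v‖ + b * ‖A v‖) :
    ∃ u, ∀ v, inner ℝ (R u) (R v) + c ^ 2 * inner ℝ (A u) (A v) = F v := by
  have hA' : Function.Injective (c • A) := by
    intro x y h
    exact hA (smul_right_injective H hc.ne' h)
  have hcl' : PairClosedRange (c • A) R := by
    intro x r s h1 h2
    obtain ⟨u, hu1, hu2⟩ := hcl x r (c⁻¹ • s) h1 ((h2.const_smul c⁻¹).congr fun n => by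
      simp [smul_smul, hc.ne'])
    exact ⟨u, hu1, by simp [hu2, smul_smul, hc.ne']⟩
  obtain ⟨u, hu⟩ := exists_riesz_pair_one hA' hcl' F (a + b / c) (by
    intro v
    refine (hF v).trans ?_
    have h1 := norm_fst_le_energyNorm (c • A) R 1 v
    have h2 := norm_snd_le_energyNorm (c • A) R 1 v
    rw [one_mul, LinearMap.smul_apply, norm_smul, Real.norm_of_nonneg hc.le] at h2
    have h3 : b * ‖A v‖ = b / c * (c * ‖A v‖) := by field_simp
    rw [add_mul, h3]
    gcongr)
  refine ⟨u, fun v => ?_⟩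
  rw [← hu v, LinearMap.smul_apply, LinearMap.smul_apply, real_inner_smul_left,
    real_inner_smul_right]
  ring

theorem exists_inner_eq [CompleteSpace H] (G : H →ₗ[ℝ] ℝ) (b : ℝ)
    (hG : ∀ g, |G g| ≤ b * ‖g‖) : ∃ y : H, ∀ g, G g = inner ℝ y g :=
  ⟨(InnerProductSpace.toDual ℝ H).symm (G.mkContinuous b hG), fun g => by
    rw [InnerProductSpace.toDual_symm_apply]
    rfl⟩

theorem norm_le_of_abs_inner_le {y : H} {b : ℝ} (hb : 0 ≤ b)
    (h : ∀ g, |inner ℝ y g| ≤ b * ‖g‖) : ‖y‖ ≤ b := by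
  have h1 := h y
  rw [real_inner_self_eq_norm_sq, abs_of_nonneg (sq_nonneg _)] at h1
  by_contra! h2
  nlinarith [norm_nonneg y]

/-- The saddle-point system for abstract operators `A`, `R`. -/
def SaddleSystem (A : U →ₗ[ℝ] H) (R : U →ₗ[ℝ] P) (β κ : ℝ) (F : U → ℝ) (G K : H → ℝ)
    (u : U) (f l : H) : Prop :=
  (∀ v, inner ℝ (R u) (R v) + inner ℝ l (A v) = F v) ∧
  (∀ g, β ^ 2 * inner ℝ f g + inner ℝ l (-g) = G g) ∧
  (∀ m, inner ℝ (A u - f) m - κ * inner ℝ l m = K m)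

/-- The second and third equations are tested by all of `H`, so they hold as identities between
vectors; this is what permits eliminating `f` and `l` algebraically. -/
theorem saddleSystem_iff {A : U →ₗ[ℝ] H} {R : U →ₗ[ℝ] P} {β κ : ℝ} {F : U → ℝ} {G K : H → ℝ}
    {y z : H} (hG : ∀ g, G g = inner ℝ y g) (hK : ∀ g, K g = inner ℝ z g)
    {u : U} {f l : H} :
    SaddleSystem A R β κ F G K u f l ↔
      (∀ v, inner ℝ (R u) (R v) + inner ℝ l (A v) = F v) ∧
      β ^ 2 • f - l = y ∧ A u - f - κ • l = z := by
  refine and_congr Iff.rfl (and_congr ?_ ?_)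
  · rw [ext_iff_inner_right ℝ]
    refine forall_congr' fun g => ?_
    rw [hG, inner_neg_right, inner_sub_left, real_inner_smul_left, sub_eq_add_neg]
  · rw [ext_iff_inner_right ℝ]
    refine forall_congr' fun g => ?_
    rw [hK, inner_sub_left _ (κ • l), real_inner_smul_left]

/-- Existence for the saddle-point system. -/
theorem SaddleSystem.exists [CompleteSpace H] [CompleteSpace P] {A : U →ₗ[ℝ] H}
    {R : U →ₗ[ℝ] P} (hA : Function.Injective A) (hcl : PairClosedRange A R)
    {β κ : ℝ} (hβ : 0 < β) (hκ : 0 ≤ κ) (F : U →ₗ[ℝ] ℝ) (G K : H →ₗ[ℝ] ℝ) {a b c : ℝ}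
    (ha : 0 ≤ a) (hF : ∀ v, |F v| ≤ a * energyNorm A R β v)
    (hG : ∀ g, |G g| ≤ b * ‖g‖) (hK : ∀ g, |K g| ≤ c * ‖g‖) :
    ∃ u f l, SaddleSystem A R β κ F G K u f l := by
  obtain ⟨y, hy⟩ := exists_inner_eq G b hG
  obtain ⟨z, hz⟩ := exists_inner_eq K c hK
  have hD : 0 < 1 + κ * β ^ 2 := by positivity
  -- Elimination gives `l = θ (β² (A u - z) - y) = θ β² A u - w`, so `w` moves to the right-hand
  -- side of the equation for `u`.
  set θ : ℝ := (1 + κ * β ^ 2)⁻¹ with hθ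
  have hθ0 : 0 < θ := inv_pos.mpr hD
  have hθD : θ * (1 + κ * β ^ 2) = 1 := inv_mul_cancel₀ hD.ne'
  let w : H := θ • (β ^ 2 • z + y)
  have hN : ∀ v, energyNorm A R β v ≤ ‖R v‖ + β * ‖A v‖ := fun v =>
    Real.sqrt_le_iff.mpr ⟨by positivity, by
      nlinarith [mul_nonneg (norm_nonneg (R v)) (mul_nonneg hβ.le (norm_nonneg (A v)))]⟩
  -- The square root makes the weight `c²` equal to `θ β²`.
  obtain ⟨u, hu⟩ := exists_riesz_pair hA hcl (c := Real.sqrt θ * β) (by positivity)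
    (F + (innerSL ℝ w).toLinearMap ∘ₗ A) a (a * β + ‖w‖) ha (by positivity) (by
      intro v
      have h1 := abs_real_inner_le_norm w (A v)
      have h2 := (hF v).trans (mul_le_mul_of_nonneg_left (hN v) ha)
      have h3 := abs_add_le (F v) (inner ℝ w (A v))
      simp only [LinearMap.add_apply, LinearMap.comp_apply, ContinuousLinearMap.coe_coe,
        innerSL_apply_apply]
      linarith)
  rw [mul_pow, Real.sq_sqrt hθ0.le] at hu
  let l : H := θ • (β ^ 2 • (A u - z) - y)
  let f : H := A u - κ • l - z
  refine ⟨u, f, l, (saddleSystem_iff hy hz).mpr ⟨fun v => ?_, ?_, ?_⟩⟩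
  · have h := hu v
    simp only [LinearMap.add_apply, LinearMap.comp_apply, ContinuousLinearMap.coe_coe,
      innerSL_apply_apply] at h
    have h2 : inner ℝ l (A v) = θ * β ^ 2 * inner ℝ (A u) (A v) - inner ℝ w (A v) := by
      simp only [l, w, real_inner_smul_left, inner_sub_left, inner_add_left]
      ring
    linarith
  · have h1 : (1 + κ * β ^ 2) • l = β ^ 2 • (A u - z) - y := by
      simp only [l, smul_smul]
      rw [mul_comm, hθD, one_smul]
    have h2 : β ^ 2 • f - l - y = (β ^ 2 • (A u - z) - y) - (1 + κ * β ^ 2) • l := by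
      simp only [f]
      module
    rw [← sub_eq_zero, h2, h1, sub_self]
  · simp only [f]
    abel

/-- The a priori estimate for the saddle-point system. -/
theorem SaddleSystem.bound [CompleteSpace H] {A : U →ₗ[ℝ] H} {R : U →ₗ[ℝ] P}
    {β κ : ℝ} (hβ : 0 < β) (hκ : 0 ≤ κ) (F : U →ₗ[ℝ] ℝ) (G K : H →ₗ[ℝ] ℝ) {a b c : ℝ}
    (ha : 0 ≤ a) (hb : 0 ≤ b) (hc : 0 ≤ c) (hF : ∀ v, |F v| ≤ a * energyNorm A R β v)
    (hG : ∀ g, |G g| ≤ b * (β * ‖g‖)) (hK : ∀ g, |K g| ≤ c * (1 / β * ‖g‖))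
    {u : U} {f l : H} (h : SaddleSystem A R β κ F G K u f l) :
    energyNorm A R β u + β * ‖f‖ + 1 / β * ‖l‖ ≤ 5 * (1 + κ * β ^ 2) * (a + b + c) := by
  simp only [← mul_assoc] at hG hK
  obtain ⟨y, hy⟩ := exists_inner_eq G _ hG
  obtain ⟨z, hz⟩ := exists_inner_eq K _ hK
  obtain ⟨h1, h2, h3⟩ := (saddleSystem_iff hy hz).mp h
  have hyb : ‖y‖ ≤ b * β := norm_le_of_abs_inner_le (by positivity) fun g => by
    rw [← hy]; exact hG g
  have hzb : ‖z‖ ≤ c * (1 / β) := norm_le_of_abs_inner_le (by positivity) fun g => by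
    rw [← hz]; exact hK g
  have hzb' : β * ‖z‖ ≤ c := by
    calc β * ‖z‖ ≤ β * (c * (1 / β)) := by gcongr
      _ = c := by field_simp
  set D : ℝ := 1 + κ * β ^ 2 with hD
  have hD1 : 1 ≤ D := by rw [hD]; nlinarith [mul_nonneg hκ (sq_nonneg β)]
  -- The two identities solved for `l` and `f`; `D` is the determinant of this linear system up to
  -- sign.
  have hl : D • l = β ^ 2 • A u - (β ^ 2 • z + y) := by
    rw [← h2, ← h3, hD]; module
  have hf : D • f = A u + (κ • y - z) := by
    rw [← h2, ← h3, hD]; module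
  set N := energyNorm A R β u with hNdef
  have hN0 : 0 ≤ N := energyNorm_nonneg A R β u
  have hAN : β * ‖A u‖ ≤ N := norm_snd_le_energyNorm A R β u
  have hN2 : N ^ 2 = ‖R u‖ ^ 2 + β ^ 2 * ‖A u‖ ^ 2 := energyNorm_sq A R β u
  have hw : ‖β ^ 2 • z + y‖ ≤ β * (b + c) := by
    refine (norm_add_le _ _).trans ?_
    rw [norm_smul, Real.norm_of_nonneg (by positivity)]
    nlinarith
  -- Test with `v = u` and multiply by `D`: then `D ‖R u‖² + β² ‖A u‖² = D F u + (β² z + y, A u)`.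
  -- Since `D ≥ 1`, the left side dominates `N²`, while the right side is at most `(D a + b + c) N`.
  have hNb : N ≤ D * a + b + c := by
    have e1 := h1 u
    have e2 : D * inner ℝ l (A u) = β ^ 2 * ‖A u‖ ^ 2 - inner ℝ (β ^ 2 • z + y) (A u) := by
      rw [← real_inner_smul_left, hl, inner_sub_left, real_inner_smul_left,
        real_inner_self_eq_norm_sq]
    have e3 : inner ℝ (β ^ 2 • z + y) (A u) ≤ (b + c) * N :=
      calc inner ℝ (β ^ 2 • z + y) (A u) ≤ ‖β ^ 2 • z + y‖ * ‖A u‖ := real_inner_le_norm _ _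
        _ ≤ β * (b + c) * ‖A u‖ := by gcongr
        _ = (b + c) * (β * ‖A u‖) := by ring
        _ ≤ (b + c) * N := by gcongr
    have e4 : F u ≤ a * N := (le_abs_self _).trans (hF u)
    have e5 : D * F u ≤ D * (a * N) := by gcongr
    rw [real_inner_self_eq_norm_sq] at e1
    have e6 : D * ‖R u‖ ^ 2 + D * inner ℝ l (A u) = D * F u := by rw [← e1]; ring
    have e7 : ‖R u‖ ^ 2 ≤ D * ‖R u‖ ^ 2 := le_mul_of_one_le_left (sq_nonneg _) hD1
    have e8 : N * N ≤ (D * a + b + c) * N := by nlinarith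
    by_contra! hlt
    have hNpos : 0 < N := lt_of_le_of_lt (by positivity) hlt
    exact absurd (le_of_mul_le_mul_right e8 hNpos) (not_le.mpr hlt)
  have hs : D * a + b + c ≤ D * (a + b + c) := by nlinarith
  have hfb : D * (β * ‖f‖) ≤ N + D * (a + b + c) := by
    have e1 : D * ‖f‖ ≤ ‖A u‖ + (κ * (b * β) + ‖z‖) := by
      rw [← Real.norm_of_nonneg (zero_le_one.trans hD1), ← norm_smul, hf]
      refine (norm_add_le _ _).trans (add_le_add_right ((norm_sub_le _ _).trans ?_) _)
      rw [norm_smul, Real.norm_of_nonneg hκ]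
      gcongr
    have e2 : β * (D * ‖f‖) ≤ β * (‖A u‖ + (κ * (b * β) + ‖z‖)) := by gcongr
    have e3 : κ * β ^ 2 * b ≤ D * b := by gcongr; linarith
    have e4 : c ≤ D * c := le_mul_of_one_le_left hc hD1
    have e5 : 0 ≤ D * a := by positivity
    nlinarith
  have hlb : D * (1 / β * ‖l‖) ≤ N + D * (a + b + c) := by
    have e1 : D * ‖l‖ ≤ β ^ 2 * ‖A u‖ + β * (b + c) := by
      rw [← Real.norm_of_nonneg (zero_le_one.trans hD1), ← norm_smul, hl]
      refine (norm_sub_le _ _).trans (add_le_add ?_ hw)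
      rw [norm_smul, Real.norm_of_nonneg (by positivity)]
    have e2 : D * (1 / β * ‖l‖) ≤ β * ‖A u‖ + (b + c) := by
      have : 1 / β * (D * ‖l‖) ≤ 1 / β * (β ^ 2 * ‖A u‖ + β * (b + c)) := by gcongr
      calc D * (1 / β * ‖l‖) = 1 / β * (D * ‖l‖) := by ring
        _ ≤ _ := this
        _ = β * ‖A u‖ + (b + c) := by field_simp
    have e3 : b + c ≤ D * (a + b + c) := by nlinarith
    linarith
  -- With `S = a + b + c`, the `u` part is at most `D S`, and the `f` and `l` parts are at most `2
  -- S` each because `D` cancels. As `D ≥ 1`, the sum is at most `5 D S`.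
  have hDN : N + D * (a + b + c) ≤ D * (2 * (a + b + c)) := by linarith
  have hf' := le_of_mul_le_mul_left (hfb.trans hDN) (zero_lt_one.trans_le hD1)
  have hl' := le_of_mul_le_mul_left (hlb.trans hDN) (zero_lt_one.trans_le hD1)
  have h0 : 0 ≤ a + b + c := by positivity
  nlinarith

end Abstract

/-! ### Weak derivatives and completeness of `H20 Ω` under `H²` regularity. -/

variable {d : ℕ} {Ω Γ : Set (E d)}

theorem HasWeakPartial.sub {i : Fin d} {u u' w w' : L2 Ω}
    (h : HasWeakPartial Ω i u w) (h' : HasWeakPartial Ω i u' w') :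
    HasWeakPartial Ω i (u - u') (w - w') := by
  have := h.add (h'.smul (-1))
  rwa [neg_one_smul, neg_one_smul, ← sub_eq_add_neg, ← sub_eq_add_neg] at this

theorem integral_mul_eq_inner {X : Set (E d)} (a : L2 X) {ψ : E d → ℝ}
    (hψ : MemLp ψ 2 (volume.restrict X)) :
    ∫ x in X, a x * ψ x = inner ℝ (hψ.toLp ψ) a := by
  rw [L2.inner_def]
  refine integral_congr_ae (hψ.coeFn_toLp.mono fun x hx => ?_)
  simp [hx]

/-- Weak partial derivatives pass to limits in `L²`. -/
theorem HasWeakPartial.of_tendsto {i : Fin d} {x y : ℕ → L2 Ω} {u w : L2 Ω}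
    (h : ∀ n, HasWeakPartial Ω i (x n) (y n)) (hx : Filter.Tendsto x Filter.atTop (nhds u))
    (hy : Filter.Tendsto y Filter.atTop (nhds w)) : HasWeakPartial Ω i u w := by
  intro φ hφ
  have h1 : ∀ n, inner ℝ ((hφ.memLp_partialD i).toLp _) (x n)
      = -inner ℝ (hφ.memLp.toLp φ) (y n) := fun n => by
    rw [← integral_mul_eq_inner, ← integral_mul_eq_inner]
    exact h n φ hφ
  rw [integral_mul_eq_inner u (hφ.memLp_partialD i), integral_mul_eq_inner w hφ.memLp]
  refine tendsto_nhds_unique (tendsto_const_nhds.inner hx) ?_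
  simp only [h1]
  exact (tendsto_const_nhds.inner hy).neg

theorem H20.hasWeakPartial (hΩ : IsOpen Ω) (u : H20 Ω) (i : Fin d) :
    HasWeakPartial Ω i (u : L2 Ω) (weakPartial Ω i (u : L2 Ω)) := by
  obtain ⟨⟨p, -, hp, -⟩, -⟩ := u.2
  rw [weakPartial_eq hΩ (hp i)]
  exact hp i

theorem H20.hasWeakPartial₂ (hΩ : IsOpen Ω) (u : H20 Ω) (i j : Fin d) :
    HasWeakPartial Ω j (weakPartial Ω i (u : L2 Ω))
      (weakPartial Ω j (weakPartial Ω i (u : L2 Ω))) := by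
  obtain ⟨⟨p, q, hp, hq⟩, -⟩ := u.2
  rw [weakPartial_eq hΩ (hp i), weakPartial_eq hΩ (hq i j)]
  exact hq i j

/-- The first order weak partial derivatives as linear maps on `H²₀(Ω)`. -/
noncomputable def weakPartialLin (hΩ : IsOpen Ω) (i : Fin d) : H20 Ω →ₗ[ℝ] L2 Ω where
  toFun u := weakPartial Ω i (u : L2 Ω)
  map_add' u v :=
    weakPartial_eq hΩ ((H20.hasWeakPartial hΩ u i).add (H20.hasWeakPartial hΩ v i))
  map_smul' c u := weakPartial_eq hΩ ((H20.hasWeakPartial hΩ u i).smul c)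

/-- The second order weak partial derivatives as linear maps on `H²₀(Ω)`. -/
noncomputable def weakPartialLin₂ (hΩ : IsOpen Ω) (i j : Fin d) : H20 Ω →ₗ[ℝ] L2 Ω where
  toFun u := weakPartial Ω j (weakPartial Ω i (u : L2 Ω))
  map_add' u v := by
    have h := (weakPartialLin hΩ i).map_add u v
    simp only [weakPartialLin, LinearMap.coe_mk, AddHom.coe_mk] at h
    rw [h]
    exact weakPartial_eq hΩ ((H20.hasWeakPartial₂ hΩ u i j).add (H20.hasWeakPartial₂ hΩ v i j))
  map_smul' c u := by
    have h := (weakPartialLin hΩ i).map_smul c u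
    simp only [weakPartialLin, LinearMap.coe_mk, AddHom.coe_mk] at h
    rw [h]
    exact weakPartial_eq hΩ ((H20.hasWeakPartial₂ hΩ u i j).smul c)

/-- The operator `-Δ` on `H²₀(Ω)`. -/
noncomputable def negLap (hΩ : IsOpen Ω) : H20 Ω →ₗ[ℝ] L2 Ω :=
  -∑ i, weakPartialLin₂ hΩ i i

theorem negLap_apply (hΩ : IsOpen Ω) (u : H20 Ω) : negLap hΩ u = -lap (u : L2 Ω) := by
  simp [negLap, lap, weakPartialLin₂]

theorem norm_negLap (hΩ : IsOpen Ω) (u : H20 Ω) : ‖negLap hΩ u‖ = ‖lap (u : L2 Ω)‖ := by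
  rw [negLap_apply, norm_neg]

theorem norm_le_h2Norm (u : L2 Ω) : ‖u‖ ≤ h2Norm u :=
  Real.le_sqrt_of_sq_le (by
    have h1 : 0 ≤ ∑ i, ‖weakPartial Ω i u‖ ^ 2 := Finset.sum_nonneg fun _ _ => sq_nonneg _
    have h2 : 0 ≤ ∑ i, ∑ j, ‖weakPartial Ω j (weakPartial Ω i u)‖ ^ 2 :=
      Finset.sum_nonneg fun _ _ => Finset.sum_nonneg fun _ _ => sq_nonneg _
    linarith)

theorem norm_weakPartial_le_h2Norm (u : L2 Ω) (i : Fin d) : ‖weakPartial Ω i u‖ ≤ h2Norm u :=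
  Real.le_sqrt_of_sq_le (by
    have h1 := Finset.single_le_sum (f := fun i => ‖weakPartial Ω i u‖ ^ 2)
      (fun _ _ => sq_nonneg _) (Finset.mem_univ i)
    have h2 : 0 ≤ ∑ i, ∑ j, ‖weakPartial Ω j (weakPartial Ω i u)‖ ^ 2 :=
      Finset.sum_nonneg fun _ _ => Finset.sum_nonneg fun _ _ => sq_nonneg _
    have h3 := sq_nonneg ‖u‖
    linarith)

theorem norm_weakPartial₂_le_h2Norm (u : L2 Ω) (i j : Fin d) :
    ‖weakPartial Ω j (weakPartial Ω i u)‖ ≤ h2Norm u :=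
  Real.le_sqrt_of_sq_le (by
    have h1 := Finset.single_le_sum (f := fun j => ‖weakPartial Ω j (weakPartial Ω i u)‖ ^ 2)
      (fun _ _ => sq_nonneg _) (Finset.mem_univ j)
    have h2 := Finset.single_le_sum
      (f := fun i => ∑ j, ‖weakPartial Ω j (weakPartial Ω i u)‖ ^ 2)
      (fun _ _ => Finset.sum_nonneg fun _ _ => sq_nonneg _) (Finset.mem_univ i)
    have h3 : 0 ≤ ∑ i, ‖weakPartial Ω i u‖ ^ 2 := Finset.sum_nonneg fun _ _ => sq_nonneg _
    have h4 := sq_nonneg ‖u‖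
    linarith)

theorem negLap_injective (hΩ : IsOpen Ω) {C : ℝ} (hreg : H2Regularity Ω C) :
    Function.Injective (negLap hΩ) := by
  rw [injective_iff_map_eq_zero]
  intro u hu
  have h := (norm_le_h2Norm (u : L2 Ω)).trans (hreg u)
  rw [← norm_negLap hΩ, hu, norm_zero, mul_zero] at h
  exact Subtype.ext (norm_le_zero_iff.mp h)

/-- A linear image of a sequence is convergent if it is controlled by a convergent one. -/
theorem exists_tendsto_of_norm_le {U H H' : Type*} [AddCommGroup U] [Module ℝ U]
    [NormedAddCommGroup H] [NormedSpace ℝ H] [NormedAddCommGroup H'] [NormedSpace ℝ H']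
    [CompleteSpace H'] (A : U →ₗ[ℝ] H) (B : U →ₗ[ℝ] H') (C : ℝ)
    (h : ∀ u, ‖B u‖ ≤ C * ‖A u‖) (x : ℕ → U) {s : H}
    (hs : Filter.Tendsto (fun n => A (x n)) Filter.atTop (nhds s)) :
    ∃ t, Filter.Tendsto (fun n => B (x n)) Filter.atTop (nhds t) := by
  refine cauchySeq_tendsto_of_complete (Metric.cauchySeq_iff.mpr fun ε hε => ?_)
  -- No sign is assumed for `C`, and `|C| + 1` is positive in every case.
  obtain ⟨N, hN⟩ := Metric.cauchySeq_iff.mp hs.cauchySeq (ε / (|C| + 1)) (by positivity)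
  refine ⟨N, fun m hm n hn => ?_⟩
  have h1 := hN m hm n hn
  rw [dist_eq_norm, ← map_sub] at h1 ⊢
  rw [lt_div_iff₀ (by positivity)] at h1
  have h2 := h (x m - x n)
  nlinarith [mul_le_mul_of_nonneg_right (le_abs_self C) (norm_nonneg (A (x m - x n))),
    norm_nonneg (A (x m - x n))]

/-- `H²₀(Ω)` is complete with respect to `‖Δu‖`. -/
theorem exists_tendsto_H20 (hΩ : IsOpen Ω) {C : ℝ} (hreg : H2Regularity Ω C)
    (x : ℕ → H20 Ω) {s : L2 Ω}
    (hs : Filter.Tendsto (fun n => negLap hΩ (x n)) Filter.atTop (nhds s)) :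
    ∃ u : H20 Ω, Filter.Tendsto (fun n => (x n : L2 Ω)) Filter.atTop (nhds (u : L2 Ω)) ∧
      negLap hΩ u = s := by
  have hreg' : ∀ u : H20 Ω, h2Norm (u : L2 Ω) ≤ C * ‖negLap hΩ u‖ := fun u => by
    rw [norm_negLap]; exact hreg u
  obtain ⟨u, hu⟩ := exists_tendsto_of_norm_le (negLap hΩ) (H20 Ω).subtype C
    (fun u => (norm_le_h2Norm _).trans (hreg' u)) x hs
  have hp : ∀ i, ∃ t, Filter.Tendsto (fun n => weakPartialLin hΩ i (x n)) Filter.atTop (nhds t) :=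
    fun i => exists_tendsto_of_norm_le (negLap hΩ) (weakPartialLin hΩ i) C
      (fun u => (norm_weakPartial_le_h2Norm _ i).trans (hreg' u)) x hs
  have hq : ∀ i j, ∃ t,
      Filter.Tendsto (fun n => weakPartialLin₂ hΩ i j (x n)) Filter.atTop (nhds t) :=
    fun i j => exists_tendsto_of_norm_le (negLap hΩ) (weakPartialLin₂ hΩ i j) C
      (fun u => (norm_weakPartial₂_le_h2Norm _ i j).trans (hreg' u)) x hs
  choose p hp using hp
  choose q hq using hq
  have hup : ∀ i, HasWeakPartial Ω i u (p i) := fun i =>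
    HasWeakPartial.of_tendsto (fun n => H20.hasWeakPartial hΩ (x n) i) hu (hp i)
  have hpq : ∀ i j, HasWeakPartial Ω j (p i) (q i j) := fun i j =>
    HasWeakPartial.of_tendsto (fun n => H20.hasWeakPartial₂ hΩ (x n) i j) (hp i) (hq i j)
  -- Diagonal argument: a test function close to `x n` in `H¹` is close to `u` once `n` is large;
  -- there are only finitely many indices `i`, so one `n` serves all of them.
  have hu0 : MemH10 Ω u := by
    refine ⟨p, hup, fun ε hε => ?_⟩
    have e1 : ∀ᶠ n in Filter.atTop, dist (x n : L2 Ω) u < ε / 2 :=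
      hu.eventually (Metric.ball_mem_nhds _ (half_pos hε))
    have e2 : ∀ᶠ n in Filter.atTop, ∀ i, dist (weakPartialLin hΩ i (x n)) (p i) < ε / 2 :=
      Filter.eventually_all.mpr fun i =>
        (hp i).eventually (Metric.ball_mem_nhds _ (half_pos hε))
    obtain ⟨n, h1, h2⟩ := (e1.and e2).exists
    obtain ⟨-, r, hr, happ⟩ := (x n).2
    obtain ⟨φ, hφ, h3, h4⟩ := happ (ε / 2) (half_pos hε)
    refine ⟨φ, hφ, ?_, fun i => ?_⟩
    · rw [dist_comm, dist_eq_norm] at h1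
      exact (norm_sub_le_norm_sub_add_norm_sub _ _ _).trans_lt (by linarith)
    · have h5 := h2 i
      have h6 : weakPartialLin hΩ i (x n) = r i := weakPartial_eq hΩ (hr i)
      rw [dist_comm, dist_eq_norm, h6] at h5
      exact (norm_sub_le_norm_sub_add_norm_sub _ _ _).trans_lt (by linarith [h4 i])
  refine ⟨⟨u, ⟨p, q, hup, hpq⟩, hu0⟩, hu, ?_⟩
  have hlim : Filter.Tendsto (fun n => negLap hΩ (x n)) Filter.atTop (nhds (-∑ i, q i i)) := by
    simp only [negLap, LinearMap.neg_apply, LinearMap.sum_apply]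
    exact (tendsto_finsetSum _ fun i _ => hq i i).neg
  rw [tendsto_nhds_unique hs hlim, negLap_apply, lap]
  congr 1
  refine Finset.sum_congr rfl fun i _ => ?_
  rw [weakPartial_eq hΩ (hup i), weakPartial_eq hΩ (hpq i i)]

/-! ### The observation operator and the passage to the abstract system. -/

/-- Restriction of functions in `L²(Ω)` to a subset `Γ`. -/
noncomputable def restrictL2 (h : Γ ⊆ Ω) : L2 Ω →L[ℝ] L2 Γ :=
  LinearMap.mkContinuous
    { toFun := fun u => ((Lp.memLp u).mono_measure (Measure.restrict_mono h le_rfl)).toLp u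
      map_add' := fun u v => by
        rw [← MemLp.toLp_add]
        refine MemLp.toLp_congr _ _ ?_
        exact (Measure.absolutelyContinuous_of_le (Measure.restrict_mono h le_rfl)).ae_le
          (Lp.coeFn_add u v)
      map_smul' := fun c u => by
        rw [RingHom.id_apply, ← MemLp.toLp_const_smul]
        refine MemLp.toLp_congr _ _ ?_
        exact (Measure.absolutelyContinuous_of_le (Measure.restrict_mono h le_rfl)).ae_le
          (Lp.coeFn_smul c u) } 1 (fun u => by
    rw [one_mul]
    simp only [LinearMap.coe_mk, AddHom.coe_mk, Lp.norm_toLp]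
    rw [Lp.norm_def]
    exact ENNReal.toReal_mono (Lp.eLpNorm_ne_top u)
      (eLpNorm_mono_measure _ (Measure.restrict_mono h le_rfl)))

theorem coeFn_restrictL2 (h : Γ ⊆ Ω) (u : L2 Ω) :
    restrictL2 h u =ᵐ[volume.restrict Γ] u :=
  MemLp.coeFn_toLp ((Lp.memLp u).mono_measure (Measure.restrict_mono h le_rfl))

theorem innerOn_restrictL2 (h : Γ ⊆ Ω) (u v : L2 Ω) :
    innerOn Γ u v = inner ℝ (restrictL2 h u) (restrictL2 h v) := by
  rw [innerOn, L2.inner_def]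
  refine integral_congr_ae ?_
  filter_upwards [coeFn_restrictL2 h u, coeFn_restrictL2 h v] with x hu hv
  simp [hu, hv, mul_comm]

theorem innerOn_restrictL2_right (h : Γ ⊆ Ω) (w : L2 Γ) (v : L2 Ω) :
    innerOn Γ w v = inner ℝ w (restrictL2 h v) := by
  rw [innerOn, L2.inner_def]
  refine integral_congr_ae ?_
  filter_upwards [coeFn_restrictL2 h v] with x hv
  simp [hv, mul_comm]

theorem integral_sub_sq_restrictL2 (h : Γ ⊆ Ω) (w : L2 Γ) (v : L2 Ω) :
    ∫ x in Γ, (v x - w x) ^ 2 = ‖restrictL2 h v - w‖ ^ 2 := by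
  rw [← real_inner_self_eq_norm_sq, L2.inner_def]
  refine integral_congr_ae ?_
  filter_upwards [coeFn_restrictL2 h v, Lp.coeFn_sub (restrictL2 h v) w] with x hv hs
  rw [hs, Pi.sub_apply, hv, real_inner_self_eq_norm_sq, Real.norm_eq_abs, sq_abs]

/-- The observation operator `u ↦ u|_Γ` on `H²₀(Ω)`. -/
noncomputable def obs (h : Γ ⊆ Ω) : H20 Ω →ₗ[ℝ] L2 Γ :=
  (restrictL2 h).toLinearMap ∘ₗ (H20 Ω).subtype

/-- Convergence of the Laplacians already yields a limit in `H20 Ω`; continuity of restriction on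
`L²` then forces the value of the other limit. -/
theorem pairClosedRange_negLap_obs (hΩ : IsOpen Ω) (hΓ : Γ ⊆ Ω) {C : ℝ}
    (hreg : H2Regularity Ω C) : PairClosedRange (negLap hΩ) (obs hΓ) := by
  intro x r s hr hs
  obtain ⟨u, hu, hus⟩ := exists_tendsto_H20 hΩ hreg x hs
  exact ⟨u, tendsto_nhds_unique (((restrictL2 hΓ).continuous.tendsto _).comp hu) hr, hus⟩

theorem vNorm_eq_energyNorm (hΩ : IsOpen Ω) (hΓ : Γ ⊆ Ω) (β : ℝ) (u : H20 Ω) :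
    vNorm Γ β u = energyNorm (negLap hΩ) (obs hΓ) β u := by
  rw [vNorm, energyNorm, innerOn_restrictL2 hΓ, real_inner_self_eq_norm_sq, norm_negLap]
  rfl

theorem isSaddleSolution_iff (hΩ : IsOpen Ω) (hΓ : Γ ⊆ Ω) {β κ : ℝ} {F : H20 Ω → ℝ}
    {G K : L2 Ω → ℝ} {u : H20 Ω} {f l : L2 Ω} :
    IsSaddleSolution Γ β κ F G K u f l ↔
      SaddleSystem (negLap hΩ) (obs hΓ) β κ F G K u f l := by
  simp only [IsSaddleSolution, SaddleSystem, innerOn_restrictL2 hΓ, negLap_apply]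
  rfl

theorem vNorm_nonneg (Γ : Set (E d)) (β : ℝ) (u : H20 Ω) : 0 ≤ vNorm Γ β u := Real.sqrt_nonneg _

theorem gNorm_nonneg {β : ℝ} (hβ : 0 < β) (f : L2 Ω) : 0 ≤ gNorm β f :=
  mul_nonneg hβ.le (norm_nonneg f)

theorem mNorm_nonneg {β : ℝ} (hβ : 0 < β) (l : L2 Ω) : 0 ≤ mNorm β l :=
  mul_nonneg (one_div_pos.mpr hβ).le (norm_nonneg l)

theorem IsSaddleSolution.bound (hΩ : IsOpen Ω) (hΓ : Γ ⊆ Ω)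
    {β κ : ℝ} (hβ : 0 < β) (hκ : 0 ≤ κ) {F : H20 Ω →ₗ[ℝ] ℝ} {G H : L2 Ω →ₗ[ℝ] ℝ} {a b c : ℝ}
    (ha : 0 ≤ a) (hb : 0 ≤ b) (hc : 0 ≤ c) (hF : ∀ v, |F v| ≤ a * vNorm Γ β v)
    (hG : ∀ g, |G g| ≤ b * gNorm β g) (hH : ∀ m, |H m| ≤ c * mNorm β m)
    {u : H20 Ω} {f l : L2 Ω} (h : IsSaddleSolution Γ β κ F G H u f l) :
    vNorm Γ β u + gNorm β f + mNorm β l ≤ 5 * (1 + κ * β ^ 2) * (a + b + c) := by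
  simp only [vNorm_eq_energyNorm hΩ hΓ] at hF ⊢
  exact SaddleSystem.bound hβ hκ F G H ha hb hc hF hG hH ((isSaddleSolution_iff hΩ hΓ).mp h)

theorem IsSaddleSolution.sub (hΩ : IsOpen Ω) (hΓ : Γ ⊆ Ω) {β κ : ℝ}
    {F F' : H20 Ω →ₗ[ℝ] ℝ} {G G' H H' : L2 Ω →ₗ[ℝ] ℝ} {u u' : H20 Ω} {f f' l l' : L2 Ω}
    (h : IsSaddleSolution Γ β κ F G H u f l) (h' : IsSaddleSolution Γ β κ F' G' H' u' f' l') :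
    IsSaddleSolution Γ β κ (F - F' : H20 Ω →ₗ[ℝ] ℝ) (G - G' : L2 Ω →ₗ[ℝ] ℝ)
      (H - H' : L2 Ω →ₗ[ℝ] ℝ) (u - u') (f - f') (l - l') := by
  rw [isSaddleSolution_iff hΩ hΓ] at h h' ⊢
  obtain ⟨h1, h2, h3⟩ := h
  obtain ⟨h1', h2', h3'⟩ := h'
  refine ⟨fun v => ?_, fun g => ?_, fun m => ?_⟩
  · rw [LinearMap.sub_apply, ← h1, ← h1', map_sub, inner_sub_left, inner_sub_left]
    ring
  · rw [LinearMap.sub_apply, ← h2, ← h2', inner_sub_left, inner_sub_left]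
    ring
  · rw [LinearMap.sub_apply, ← h3, ← h3', map_sub]
    simp only [inner_sub_left]
    ring

theorem eq_zero_of_vNorm_eq_zero (hΩ : IsOpen Ω) (hΓ : Γ ⊆ Ω) {C : ℝ}
    (hreg : H2Regularity Ω C) {β : ℝ} (hβ : 0 < β) {u : H20 Ω} (h : vNorm Γ β u = 0) :
    u = 0 := by
  rw [vNorm_eq_energyNorm hΩ hΓ] at h
  have h1 := norm_snd_le_energyNorm (negLap hΩ) (obs hΓ) β u
  rw [h] at h1
  refine negLap_injective hΩ hreg ?_
  rw [map_zero, ← norm_le_zero_iff]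
  exact nonpos_of_mul_nonpos_right h1 hβ

theorem IsSaddleSolution.unique (hΩ : IsOpen Ω) (hΓ : Γ ⊆ Ω) {C : ℝ}
    (hreg : H2Regularity Ω C) {β κ : ℝ} (hβ : 0 < β) (hκ : 0 ≤ κ)
    {F : H20 Ω →ₗ[ℝ] ℝ} {G H : L2 Ω →ₗ[ℝ] ℝ} {u u' : H20 Ω} {f f' l l' : L2 Ω}
    (h : IsSaddleSolution Γ β κ F G H u f l) (h' : IsSaddleSolution Γ β κ F G H u' f' l') :
    u = u' ∧ f = f' ∧ l = l' := by
  -- The difference solves the homogeneous system, so the a priori estimate with zero data makes all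
  -- three norms vanish.
  have hb := (h.sub hΩ hΓ h').bound hΩ hΓ hβ hκ (a := 0) (b := 0) (c := 0) le_rfl le_rfl le_rfl
    (by simp) (by simp) (by simp)
  have h1 := vNorm_nonneg Γ β (u - u')
  have h2 := gNorm_nonneg hβ (f - f')
  have h3 := mNorm_nonneg hβ (l - l')
  have h4 : β * ‖f - f'‖ = 0 := le_antisymm (by simp only [gNorm] at *; linarith) h2
  have h5 : 1 / β * ‖l - l'‖ = 0 := le_antisymm (by simp only [mNorm] at *; linarith) h3
  refine ⟨sub_eq_zero.mp (eq_zero_of_vNorm_eq_zero hΩ hΓ hreg hβ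
    (le_antisymm (by linarith) h1)), ?_, ?_⟩
  · simpa [hβ.ne', sub_eq_zero] using h4
  · simpa [hβ.ne', sub_eq_zero] using h5

theorem IsSaddleSolution.existsUnique (hΩ : IsOpen Ω) (hΓ : Γ ⊆ Ω) {C : ℝ}
    (hreg : H2Regularity Ω C) {β κ : ℝ} (hβ : 0 < β) (hκ : 0 ≤ κ)
    (F : H20 Ω →ₗ[ℝ] ℝ) (G H : L2 Ω →ₗ[ℝ] ℝ) {a b c : ℝ} (ha : 0 ≤ a)
    (hF : ∀ v, |F v| ≤ a * vNorm Γ β v)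
    (hG : ∀ g, |G g| ≤ b * gNorm β g) (hH : ∀ m, |H m| ≤ c * mNorm β m) :
    ∃! s : H20 Ω × L2 Ω × L2 Ω, IsSaddleSolution Γ β κ F G H s.1 s.2.1 s.2.2 := by
  simp only [vNorm_eq_energyNorm hΩ hΓ] at hF
  obtain ⟨u, f, l, h⟩ := SaddleSystem.exists (negLap_injective hΩ hreg)
    (pairClosedRange_negLap_obs hΩ hΓ hreg) hβ hκ F G H (b := b * β) (c := c * (1 / β)) ha hF
    (fun g => by rw [mul_assoc]; exact hG g) (fun g => by rw [mul_assoc]; exact hH g)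
  rw [← isSaddleSolution_iff hΩ hΓ] at h
  refine ⟨(u, f, l), h, fun s hs => ?_⟩
  obtain ⟨h1, h2, h3⟩ := hs.unique hΩ hΓ hreg hβ hκ h
  exact Prod.ext h1 (Prod.ext h2 h3)

/-! ### The data functionals with their dual norms, and well-posedness of (C). -/

/-- The functional `v ↦ (u_d, v)_Γ` on `H²₀(Ω)`. -/
noncomputable def obsRhsLin (hΓ : Γ ⊆ Ω) (ud : L2 Γ) : H20 Ω →ₗ[ℝ] ℝ :=
  (innerSL ℝ ud).toLinearMap ∘ₗ obs hΓ

theorem coe_obsRhsLin (hΓ : Γ ⊆ Ω) (ud : L2 Γ) : ⇑(obsRhsLin hΓ ud) = obsRhs Ω ud := by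
  funext v
  exact (innerOn_restrictL2_right hΓ ud v).symm

theorem obsRhsLin_sub (hΓ : Γ ⊆ Ω) (ud ud' : L2 Γ) :
    obsRhsLin hΓ ud - obsRhsLin hΓ ud' = obsRhsLin hΓ (ud - ud') := by
  ext v
  simp [obsRhsLin]

theorem abs_obsRhsLin_le (hΩ : IsOpen Ω) (hΓ : Γ ⊆ Ω) (β : ℝ) (ud : L2 Γ) (v : H20 Ω) :
    |obsRhsLin hΓ ud v| ≤ ‖ud‖ * vNorm Γ β v := by
  rw [vNorm_eq_energyNorm hΩ hΓ]
  exact (abs_real_inner_le_norm _ _).trans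
    (mul_le_mul_of_nonneg_left (norm_fst_le_energyNorm _ _ β v) (norm_nonneg ud))

/-- The functional `g ↦ β² (f_p, g)_Ω` on `L²(Ω)`. -/
noncomputable def priorRhsLin (β : ℝ) (fp : L2 Ω) : L2 Ω →ₗ[ℝ] ℝ :=
  β ^ 2 • (innerSL ℝ fp).toLinearMap

theorem coe_priorRhsLin (β : ℝ) (fp : L2 Ω) : ⇑(priorRhsLin β fp) = priorRhs β fp := rfl

theorem priorRhsLin_sub (β : ℝ) (fp fp' : L2 Ω) :
    priorRhsLin β fp - priorRhsLin β fp' = priorRhsLin β (fp - fp') := by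
  ext v
  simp [priorRhsLin, mul_sub]

theorem abs_priorRhsLin_le {β : ℝ} (fp g : L2 Ω) :
    |priorRhsLin β fp g| ≤ gNorm β fp * gNorm β g := by
  rw [coe_priorRhsLin, priorRhs, gNorm, gNorm, abs_mul, abs_of_nonneg (sq_nonneg β)]
  calc β ^ 2 * |inner ℝ fp g| ≤ β ^ 2 * (‖fp‖ * ‖g‖) := by
        gcongr; exact abs_real_inner_le_norm _ _
    _ = β * ‖fp‖ * (β * ‖g‖) := by ring

theorem saddleWellPosed (hΩ : IsOpen Ω) (hΓ : Γ ⊆ Ω) {C : ℝ}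
    (hreg : H2Regularity Ω C) {β κ K : ℝ} (hβ : 0 < β) (hκ : 0 ≤ κ)
    (hK : 5 * (1 + κ * β ^ 2) ≤ K) : SaddleWellPosed Ω Γ β κ K := by
  refine ⟨fun ud fp => ?_, fun ud ud' fp fp' u u' f f' l l' h h' => ?_,
    fun F G H a b c ha hb hc hF hG hH => ⟨?_, fun u f l h => ?_⟩⟩
  · rw [← coe_obsRhsLin hΓ, ← coe_priorRhsLin]
    exact IsSaddleSolution.existsUnique hΩ hΓ hreg hβ hκ _ _ 0 (norm_nonneg ud)
      (abs_obsRhsLin_le hΩ hΓ β ud) (abs_priorRhsLin_le fp) (c := 0) (by simp)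
  · rw [← coe_obsRhsLin hΓ, ← coe_priorRhsLin] at h h'
    have h1 := IsSaddleSolution.sub hΩ hΓ (H := 0) (H' := 0) h h'
    rw [obsRhsLin_sub, priorRhsLin_sub] at h1
    have h2 := h1.bound hΩ hΓ hβ hκ (norm_nonneg _) (gNorm_nonneg hβ _) le_rfl
      (abs_obsRhsLin_le hΩ hΓ β _) (abs_priorRhsLin_le _) (c := 0) (by simp)
    rw [add_zero] at h2
    exact h2.trans (mul_le_mul_of_nonneg_right hK
      (add_nonneg (norm_nonneg _) (gNorm_nonneg hβ _)))
  · exact IsSaddleSolution.existsUnique hΩ hΓ hreg hβ hκ F G H ha hF hG hH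
  · exact (h.bound hΩ hΓ hβ hκ ha hb hc hF hG hH).trans
      (mul_le_mul_of_nonneg_right hK (by positivity))

/-! ### From the saddle-point system (C) to the reduced system (B). -/

/-- Eliminating the multiplier `l = γ² (-Δu - f)` from the saddle-point system. -/
theorem isVarSolution_iff {β γ : ℝ} (hγ : 0 < γ) {F : H20 Ω → ℝ}
    {G : L2 Ω → ℝ} {u : H20 Ω} {f : L2 Ω} :
    IsVarSolution Γ β γ F G u f ↔
      IsSaddleSolution Γ β (1 / γ ^ 2) F G 0 u f (γ ^ 2 • (-lap (u : L2 Ω) - f)) := by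
  have hc : 1 / γ ^ 2 * γ ^ 2 = 1 := by field_simp
  refine ⟨fun ⟨h1, h2⟩ => ⟨fun v => ?_, fun g => ?_, fun m => ?_⟩,
    fun ⟨h1, h2, _⟩ => ⟨fun v => ?_, fun g => ?_⟩⟩
  · rw [← h1, real_inner_smul_left]
  · rw [← h2, real_inner_smul_left, inner_sub_left, inner_neg_right f]
    ring
  · rw [real_inner_smul_left, ← mul_assoc, hc, one_mul, sub_self]
    rfl
  · rw [← h1, real_inner_smul_left]
  · rw [← h2, real_inner_smul_left, inner_sub_left _ f, inner_neg_right f]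
    ring

theorem IsSaddleSolution.multiplier_eq {β γ : ℝ} (hγ : 0 < γ) {F : H20 Ω → ℝ} {G : L2 Ω → ℝ}
    {u : H20 Ω} {f l : L2 Ω} (h : IsSaddleSolution Γ β (1 / γ ^ 2) F G 0 u f l) :
    l = γ ^ 2 • (-lap (u : L2 Ω) - f) := by
  refine ext_iff_inner_right ℝ |>.mpr fun m => ?_
  have h3 := h.2.2 m
  rw [Pi.zero_apply, sub_eq_zero] at h3
  rw [real_inner_smul_left, h3]
  field_simp

theorem existsUnique_isVarSolution {β γ : ℝ} (hγ : 0 < γ) {F : H20 Ω → ℝ} {G : L2 Ω → ℝ}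
    (h : ∃! s : H20 Ω × L2 Ω × L2 Ω, IsSaddleSolution Γ β (1 / γ ^ 2) F G 0 s.1 s.2.1 s.2.2) :
    ∃! s : H20 Ω × L2 Ω, IsVarSolution Γ β γ F G s.1 s.2 := by
  obtain ⟨⟨u, f, l⟩, h, huniq⟩ := h
  have hl := h.multiplier_eq hγ
  dsimp only at h hl
  refine ⟨(u, f), (isVarSolution_iff hγ).mpr (hl ▸ h), fun s hs => ?_⟩
  have := huniq (s.1, s.2, _) ((isVarSolution_iff hγ).mp hs)
  simp only [Prod.mk.injEq] at this
  exact Prod.ext this.1 this.2.1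

/-- (B) is (C) with zero third right-hand side, and its estimate follows by dropping the nonnegative
multiplier norm. -/
theorem SaddleWellPosed.variationalWellPosed {β γ K : ℝ} (hβ : 0 < β) (hγ : 0 < γ)
    (h : SaddleWellPosed Ω Γ β (1 / γ ^ 2) K) : VariationalWellPosed Ω Γ β γ K := by
  obtain ⟨h1, h2, h3⟩ := h
  refine ⟨fun ud fp => existsUnique_isVarSolution hγ (h1 ud fp),
    fun ud ud' fp fp' u u' f f' h h' => ?_, fun F G a b ha hb hF hG => ?_⟩
  · have := h2 ud ud' fp fp' u u' f f' _ _ ((isVarSolution_iff hγ).mp h)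
      ((isVarSolution_iff hγ).mp h')
    exact (le_add_of_nonneg_right (mNorm_nonneg hβ _)).trans this
  · obtain ⟨h4, h5⟩ := h3 F G 0 a b 0 ha hb le_rfl hF hG (by simp)
    refine ⟨existsUnique_isVarSolution hγ h4, fun u f h => ?_⟩
    have := h5 u f _ ((isVarSolution_iff hγ).mp h)
    rw [add_zero] at this
    exact (le_add_of_nonneg_right (mNorm_nonneg hβ _)).trans this

/-! ### From the reduced system (B) to the minimization problem (A). -/

/-- Second order expansion of the least squares functional at `(u, f)`. -/
theorem lossL2_add (hΩ : IsOpen Ω) (hΓ : Γ ⊆ Ω) (β γ : ℝ) (ud : L2 Γ) (fp : L2 Ω)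
    (u v : H20 Ω) (f g : L2 Ω) :
    lossL2 β γ ud fp (u + v) (f + g) = lossL2 β γ ud fp u f
      + 2 * (γ ^ 2 * inner ℝ (negLap hΩ u - f) (negLap hΩ v - g)
        + inner ℝ (obs hΓ u - ud) (obs hΓ v) + β ^ 2 * inner ℝ (f - fp) g)
      + (γ ^ 2 * ‖negLap hΩ v - g‖ ^ 2 + ‖obs hΓ v‖ ^ 2 + β ^ 2 * ‖g‖ ^ 2) := by
  have hobs : ∀ w : H20 Ω, restrictL2 hΓ (w : L2 Ω) = obs hΓ w := fun _ => rfl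
  simp only [lossL2, integral_sub_sq_restrictL2 hΓ, hobs, ← negLap_apply hΩ, map_add]
  have e1 : negLap hΩ u + negLap hΩ v - (f + g) = (negLap hΩ u - f) + (negLap hΩ v - g) := by abel
  have e2 : obs hΓ u + obs hΓ v - ud = (obs hΓ u - ud) + obs hΓ v := by abel
  have e3 : f + g - fp = (f - fp) + g := by abel
  rw [e1, e2, e3, norm_add_sq_real, norm_add_sq_real (obs hΓ u - ud), norm_add_sq_real (f - fp)]
  ring

theorem eq_zero_of_forall_quadratic_nonneg {p q : ℝ} (h : ∀ t : ℝ, 0 ≤ 2 * (t * p) + t ^ 2 * q) :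
    p = 0 := by
  have hq : 0 ≤ |q| := abs_nonneg q
  -- A step against the sign of `p`, short enough that the linear term beats the quadratic one; the
  -- `+ 1` covers `q = 0`.
  have h1 := h (-p / (|q| + 1))
  have e : 2 * (-p / (|q| + 1) * p) + (-p / (|q| + 1)) ^ 2 * q
      = p ^ 2 * (q - 2 * (|q| + 1)) / (|q| + 1) ^ 2 := by
    field_simp
    ring
  rw [e] at h1
  by_contra hp
  have h2 : 0 < p ^ 2 := by positivity
  have h3 : p ^ 2 * (q - 2 * (|q| + 1)) < 0 :=
    mul_neg_of_pos_of_neg h2 (by linarith [le_abs_self q])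
  exact absurd h1 (not_le.mpr (div_neg_of_neg_of_pos h3 (by positivity)))

/-- The Euler-Lagrange equations of the least squares functional. -/
theorem isMinimizer_iff (hΩ : IsOpen Ω) (hΓ : Γ ⊆ Ω) {β γ : ℝ} {ud : L2 Γ} {fp : L2 Ω}
    {u : H20 Ω} {f : L2 Ω} :
    IsMinimizer β γ ud fp u f ↔
      IsVarSolution Γ β γ (obsRhs Ω ud) (priorRhs β fp) u f := by
  have hvar : IsVarSolution Γ β γ (obsRhs Ω ud) (priorRhs β fp) u f ↔
      ∀ (v : H20 Ω) (g : L2 Ω), γ ^ 2 * inner ℝ (negLap hΩ u - f) (negLap hΩ v - g)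
        + inner ℝ (obs hΓ u - ud) (obs hΓ v) + β ^ 2 * inner ℝ (f - fp) g = 0 := by
    have hobs : ∀ w : H20 Ω, restrictL2 hΓ (w : L2 Ω) = obs hΓ w := fun _ => rfl
    simp only [IsVarSolution, obsRhs, priorRhs, innerOn_restrictL2 hΓ,
      innerOn_restrictL2_right hΓ, hobs, ← negLap_apply hΩ]
    refine ⟨fun ⟨h1, h2⟩ v g => ?_, fun h => ⟨fun v => ?_, fun g => ?_⟩⟩
    · have e1 := h1 v
      have e2 := h2 g
      simp only [inner_sub_left, inner_sub_right, inner_neg_right] at e1 e2 ⊢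
      linarith
    · have e := h v 0
      simp only [inner_sub_left, sub_zero, inner_zero_right] at e ⊢
      linarith
    · have e := h 0 g
      simp only [inner_sub_left, map_zero, zero_sub, inner_zero_right, inner_neg_right] at e ⊢
      linarith
  rw [hvar]
  refine ⟨fun h v g => eq_zero_of_forall_quadratic_nonneg
      (q := γ ^ 2 * ‖negLap hΩ v - g‖ ^ 2 + ‖obs hΓ v‖ ^ 2 + β ^ 2 * ‖g‖ ^ 2) fun t => ?_,
    fun h v g => ?_⟩
  · have h1 := h (u + t • v) (f + t • g)
    rw [lossL2_add hΩ hΓ, map_smul, map_smul, ← smul_sub] at h1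
    simp only [real_inner_smul_right, norm_smul, mul_pow, Real.norm_eq_abs, sq_abs] at h1
    linarith
  -- The expansion is exact: once the first order term vanishes, the increment is a sum of weighted
  -- squares.
  · have h1 := lossL2_add hΩ hΓ β γ ud fp u (v - u) f (g - f)
    rw [h, add_sub_cancel, add_sub_cancel] at h1
    rw [h1, mul_zero, add_zero]
    exact le_add_of_nonneg_right (by positivity)

theorem VariationalWellPosed.minimizationWellPosed (hΩ : IsOpen Ω) (hΓ : Γ ⊆ Ω) {β γ K : ℝ}
    (h : VariationalWellPosed Ω Γ β γ K) : MinimizationWellPosed Ω Γ β γ K := by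
  simp only [MinimizationWellPosed, isMinimizer_iff hΩ hΓ]
  exact ⟨h.1, h.2.1⟩

theorem inverseWellPosed (hΩ : IsOpen Ω) (hΓ : Γ ⊆ Ω) {C : ℝ}
    (hreg : H2Regularity Ω C) {β γ K : ℝ} (hβ : 0 < β) (hγ : 0 < γ)
    (hK : 5 * (1 + (β / γ) ^ 2) ≤ K) : InverseWellPosed Ω Γ β γ K := by
  have h1 : SaddleWellPosed Ω Γ β (1 / γ ^ 2) K :=
    saddleWellPosed hΩ hΓ hreg hβ (by positivity) (by
      rwa [one_div_mul_eq_div, ← div_pow])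
  have h2 := h1.variationalWellPosed hβ hγ
  exact ⟨h2.minimizationWellPosed hΩ hΓ, h2, h1⟩

end InverseProblem

theorem theorem2 (d : ℕ) (C : ℝ) :
    ∃ K : ℝ, ∀ Ω Γ : Set (InverseProblem.E d),
      InverseProblem.IsBoundedDomain Ω → InverseProblem.IsSubdomain Γ Ω →
      InverseProblem.H2Regularity Ω C →
      (∀ β γ : ℝ, 0 < γ → 1 / γ < β →
        InverseProblem.InverseWellPosed Ω Γ β γ (K * (1 + (β / γ) ^ 2))) ∧
      (∀ β γ : ℝ, 0 < β → β ≤ γ → InverseProblem.InverseWellPosed Ω Γ β γ K) ∧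
      (∀ β : ℝ, 0 < β → InverseProblem.SaddleWellPosed Ω Γ β 0 K) := by
  -- The estimate needs `5 (1 + (β / γ)²)`, which is at most `5 * 2` when `β ≤ γ`; the other two
  -- cases would allow `5`.
  refine ⟨10, fun Ω Γ hΩ hΓ hreg => ⟨fun β γ hγ hβγ => ?_, fun β γ hβ hβγ => ?_,
    fun β hβ => ?_⟩⟩
  · have hβ : 0 < β := (one_div_pos.mpr hγ).trans hβγ
    exact InverseProblem.inverseWellPosed hΩ.1 hΓ.2.2 hreg hβ hγ
      (mul_le_mul_of_nonneg_right (by norm_num) (by positivity))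
  · have hγ : 0 < γ := hβ.trans_le hβγ
    have h1 : (β / γ) ^ 2 ≤ 1 :=
      pow_le_one₀ (by positivity) ((div_le_one hγ).mpr hβγ)
    exact InverseProblem.inverseWellPosed hΩ.1 hΓ.2.2 hreg hβ hγ (by linarith)
  · exact InverseProblem.saddleWellPosed hΩ.1 hΓ.2.2 hreg hβ le_rfl (by norm_num)
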